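/- Let $\mathcal N=\{1,\dots,n\}$ be a set of products, $\mathcal S$ a nonempty finite collection of nonempty subsets (assortments) of $\mathcal N$, and $\mathcal I_{\mathcal S}=\{(i,S): S\in\mathcal S,\ i\in S\}$. Let $\Delta_S$ be the probability simplex in $\mathbb R^S$. A marginal distribution model (MDM) consists of $\nu\in\mathbb R^n$ and probability laws $F_1,\dots,F_n$ on $\mathbb R$, each absolutely continuous, with distribution function strictly increasing on its support and with finite first absolute moment. Let $\Theta$ be the set of joint laws of $(\tilde\epsilon_1,\dots,\tilde\epsilon_n)$ with marginals $F_1,\dots,F_n$. A vector $\boldsymbol x_{\mathcal S}=(x_{i,S})_{(i,S)\in\mathcal I_{\mathcal S}}$ is MDM-representable, $\boldsymbol x_{\mathcal S}\in\mathcal P_{\rm MDM}(\mathcal S)$, if there is one such model such that for every $S\in\mathcal S$ there is $\theta^*\in\Theta$ maximizing $\theta\mapsto\mathbb E_\theta[\max_{i\in S}(\nu_i+\tilde\epsilon_i)]$ over $\Theta$ with $x_{i,S}=\mathbb P_{\theta^*}(i=\arg\max_{j\in S}(\nu_j+\tilde\epsilon_j))$ (unique maximizer) for all $i\in S$. Let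 $\boldsymbol p_{\mathcal S}$ be choice data, i.e. $\boldsymbol p_S\in\Delta_S$ for all $S\in\mathcal S$. For each $S\in\mathcal S$ let $\mathrm{loss}_S(\boldsymbol p_S,\cdot):\Delta_S\to[0,\infty]$ be convex, and either finite everywhere on $\Delta_S$ or continuous on $\Delta_S$. The limit of MDM is $$\mathcal L(\boldsymbol p_{\mathcal S})=\inf\Big\{\sum_{S\in\mathcal S}\mathrm{loss}_S(\boldsymbol p_S,\boldsymbol x_S):\boldsymbol x_{\mathcal S}\in\mathcal P_{\rm MDM}(\mathcal S)\Big\}.$$ Then for any $0<\epsilon<1/(2|\mathcal S|)$, $\mathcal L(\boldsymbol p_{\mathcal S})$ equals the optimal value (infimum) of the mixed-integer convex program $$\begin{aligned} \min_{\boldsymbol x,\boldsymbol\lambda,\boldsymbol\delta}\ &\sum_{S\in\mathcal S}\mathrm{loss}_S(\boldsymbol p_S,\boldsymbol x_S)\\ \text{s.t. }& -\delta_{S,T}\le\lambda_S-\lambda_T\le 1-(1+\epsilon)\delta_{S,T}, && \forall (i,S),(i,T)\in\mathcal I_{\mathcal S},\\ & \delta_{S,T}-1\le x_{i,S}-x_{i,T}\le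 1-\delta_{T,S}, && \forall (i,S),(i,T)\in\mathcal I_{\mathcal S},\\ & -(\delta_{S,T}+\delta_{T,S})\le x_{i,S}-x_{i,T}\le \delta_{S,T}+\delta_{T,S}, && \forall (i,S),(i,T)\in\mathcal I_{\mathcal S},\\ & \textstyle\sum_{i\in S}x_{i,S}=1\ \ \forall S\in\mathcal S,\qquad x_{i,S}\ge 0\ \ \forall (i,S)\in\mathcal I_{\mathcal S},\\ & 0\le\lambda_S\le 1\ \ \forall S\in\mathcal S,\qquad \delta_{S,T}\in\{0,1\}\ \ \forall S,T\in\mathcal S. \end{aligned}$$ If moreover every $\mathrm{loss}_S(\boldsymbol p_S,\cdot)$ is continuous on $\Delta_S$, the minimum of the program is attained. -/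

import Mathlib

open MeasureTheory
open scoped ENNReal NNReal

namespace MDM

/-- The assumption on each marginal law: a probability measure on `ℝ` which is absolutely
continuous, whose distribution function is strictly increasing on its support, and which has a
finite first absolute moment. -/
structure IsMarginal (μ : Measure ℝ) : Prop where
  isProbabilityMeasure : IsProbabilityMeasure μ
  absolutelyContinuous : μ ≪ volume
  strictMonoOn_cdf : StrictMonoOn (ProbabilityTheory.cdf μ) μ.support
  integrable : Integrable (fun t : ℝ => t) μ

/-- The joint laws of `(ε₁, …, εₙ)` with marginal laws `F₁, …, Fₙ`. -/
def jointLaws {n : ℕ} (F : Fin n → Measure ℝ) : Set (Measure (Fin n → ℝ)) :=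
  {θ | IsProbabilityMeasure θ ∧ ∀ i, θ.map (fun e => e i) = F i}

/-- The expected utility `E_θ [max_{i ∈ S} (ν i + ε i)]` of a (nonempty) assortment `S`. -/
noncomputable def expectedUtility {n : ℕ} (ν : Fin n → ℝ) (S : Finset (Fin n))
    (θ : Measure (Fin n → ℝ)) : ℝ :=
  ∫ e, (⨆ i : S, (ν i + e i)) ∂θ

/-- `θ` is a joint law with the given marginals that maximizes the expected utility of `S`. -/
def IsExtremal {n : ℕ} (F : Fin n → Measure ℝ) (ν : Fin n → ℝ) (S : Finset (Fin n))
    (θ : Measure (Fin n → ℝ)) : Prop :=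
  θ ∈ jointLaws F ∧ IsMaxOn (expectedUtility ν S) (jointLaws F) θ

/-- The probability under `θ` that `i` is the utility-maximizing product of `S`. -/
noncomputable def choiceProb {n : ℕ} (ν : Fin n → ℝ) (S : Finset (Fin n))
    (θ : Measure (Fin n → ℝ)) (i : Fin n) : ℝ :=
  θ.real {e | ∀ j ∈ S, j ≠ i → ν j + e j < ν i + e i}

/-- Vectors `(x_{i,S} : i ∈ S, S ∈ 𝒮)`; the entry `x_{i,S}` is `x S i`. -/
abbrev ChoiceVec {n : ℕ} (𝒮 : Finset (Finset (Fin n))) : Type :=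
  (S : 𝒮) → S.1 → ℝ

/-- The choice probabilities on the collection `𝒮` which are representable by a marginal
distribution model; one model `(F, ν)` serves all the assortments. -/
def representable {n : ℕ} (𝒮 : Finset (Finset (Fin n))) : Set (ChoiceVec 𝒮) :=
  {x | ∃ (F : Fin n → Measure ℝ) (ν : Fin n → ℝ), (∀ i, IsMarginal (F i)) ∧
    ∀ S : 𝒮, ∃ θ, IsExtremal F ν S.1 θ ∧ ∀ i : S.1, x S i = choiceProb ν S.1 θ i}

/-- The total loss `∑_S loss_S(p_S, x_S)`. -/
noncomputable def totalLoss {n : ℕ} {𝒮 : Finset (Finset (Fin n))}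
    (loss : (S : 𝒮) → (S.1 → ℝ) → (S.1 → ℝ) → ℝ≥0∞) (p x : ChoiceVec 𝒮) : ℝ≥0∞ :=
  ∑ S, loss S (p S) (x S)

/-- The limit of the marginal distribution model: the smallest loss with which representable
choice probabilities fit the data `p`. -/
noncomputable def limit {n : ℕ} {𝒮 : Finset (Finset (Fin n))}
    (loss : (S : 𝒮) → (S.1 → ℝ) → (S.1 → ℝ) → ℝ≥0∞) (p : ChoiceVec 𝒮) : ℝ≥0∞ :=
  sInf (totalLoss loss p '' representable 𝒮)

/-- The constraints of the mixed-integer program in the variables `x`, `lam`, `δ`. -/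
structure IsFeasible {n : ℕ} {𝒮 : Finset (Finset (Fin n))} (ε : ℝ) (x : ChoiceVec 𝒮)
    (lam : 𝒮 → ℝ) (δ : 𝒮 → 𝒮 → ℝ) : Prop where
  order_lower : ∀ (S T : 𝒮) (i : Fin n), i ∈ S.1 → i ∈ T.1 → -δ S T ≤ lam S - lam T
  order_upper : ∀ (S T : 𝒮) (i : Fin n), i ∈ S.1 → i ∈ T.1 →
    lam S - lam T ≤ 1 - (1 + ε) * δ S T
  mono_lower : ∀ (S T : 𝒮) (i : Fin n) (hS : i ∈ S.1) (hT : i ∈ T.1),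
    δ S T - 1 ≤ x S ⟨i, hS⟩ - x T ⟨i, hT⟩
  mono_upper : ∀ (S T : 𝒮) (i : Fin n) (hS : i ∈ S.1) (hT : i ∈ T.1),
    x S ⟨i, hS⟩ - x T ⟨i, hT⟩ ≤ 1 - δ T S
  tie_lower : ∀ (S T : 𝒮) (i : Fin n) (hS : i ∈ S.1) (hT : i ∈ T.1),
    -(δ S T + δ T S) ≤ x S ⟨i, hS⟩ - x T ⟨i, hT⟩
  tie_upper : ∀ (S T : 𝒮) (i : Fin n) (hS : i ∈ S.1) (hT : i ∈ T.1),
    x S ⟨i, hS⟩ - x T ⟨i, hT⟩ ≤ δ S T + δ T S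
  sum_eq_one : ∀ S : 𝒮, ∑ i, x S i = 1
  nonneg : ∀ (S : 𝒮) (i : S.1), 0 ≤ x S i
  lam_nonneg : ∀ S : 𝒮, 0 ≤ lam S
  lam_le_one : ∀ S : 𝒮, lam S ≤ 1
  binary : ∀ S T : 𝒮, δ S T = 0 ∨ δ S T = 1

/-- The objective values attained at feasible points of the mixed-integer program. -/
def feasibleValues {n : ℕ} {𝒮 : Finset (Finset (Fin n))}
    (loss : (S : 𝒮) → (S.1 → ℝ) → (S.1 → ℝ) → ℝ≥0∞) (p : ChoiceVec 𝒮) (ε : ℝ) : Set ℝ≥0∞ :=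
  {v | ∃ (x : ChoiceVec 𝒮) (lam : 𝒮 → ℝ) (δ : 𝒮 → 𝒮 → ℝ),
    IsFeasible ε x lam δ ∧ totalLoss loss p x = v}

end MDM

/-!
For a fixed assortment, maximizing the expected utility over the joint laws is a transport problem
whose dual is one-dimensional: a multiplier `l` is optimal when the tails `P(ν i + ε i > l)` add up
to one, and these tails are then the choice probabilities. Hence the multipliers of a model rank
the assortments so that a common product is chosen at most as often from the one with the larger
multiplier. Conversely, positive choice probabilities ranked in this way, with ties only at equal
multipliers, are the tails of a suitable model.

A weak ranking is an order on finitely many assortments, so it can be encoded by binary variables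
and by levels `λ` spaced by `ε`: the feasible set of the program projects onto the compact set of
the weakly ranked choice vectors. Each of these is the endpoint of a segment all of whose other
points are representable, so the two infima agree as soon as the losses are upper semicontinuous
along segments, and the minimum is attained as soon as they are lower semicontinuous.
-/

namespace MDM

section Pointwise

variable {ι : Type*} (S : Finset ι) (v : ι → ℝ) (l : ℝ)

lemma iSup_le_add_sum_posPart (hS : S.Nonempty) :
    (⨆ i : S, v i) ≤ l + ∑ i ∈ S, max (v i - l) 0 := by
  have : Nonempty S := hS.to_subtype
  refine ciSup_le fun i => ?_
  have hterm : max (v i - l) 0 ≤ ∑ j ∈ S, max (v j - l) 0 :=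
    Finset.single_le_sum (f := fun j => max (v j - l) 0) (fun j _ => le_max_right _ _) i.2
  linarith [le_max_left (v i - l) 0]

variable {S v l}

lemma iSup_eq_add_sum_posPart {i : ι} (hi : i ∈ S) (hl : l < v i)
    (hj : ∀ j ∈ S, j ≠ i → v j ≤ l) :
    (⨆ i : S, v i) = l + ∑ i ∈ S, max (v i - l) 0 := by
  refine le_antisymm (iSup_le_add_sum_posPart S v l ⟨i, hi⟩) ?_
  rw [Finset.sum_eq_single_of_mem i hi fun j hjS hji =>
    max_eq_right (sub_nonpos.2 (hj j hjS hji)), max_eq_left (by linarith), add_sub_cancel]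
  exact le_ciSup (f := fun i : S => v i) (Set.finite_range _).bddAbove ⟨i, hi⟩

lemma isStrictMax_iff_lt_of_iSup_eq (h : (⨆ i : S, v i) = l + ∑ i ∈ S, max (v i - l) 0)
    (hne : ∀ i ∈ S, v i ≠ l) {i : ι} (hi : i ∈ S) :
    (∀ j ∈ S, j ≠ i → v j < v i) ↔ l < v i := by
  have : Nonempty S := ⟨⟨i, hi⟩⟩
  obtain ⟨⟨k, hk⟩, hkv : v k = ⨆ i : S, v i⟩ :=
    exists_eq_ciSup_of_finite (f := fun i : S => v i)
  have hnonneg : ∀ j ∈ S, 0 ≤ max (v j - l) 0 := fun j _ => le_max_right _ _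
  have hlk : l < v k :=
    lt_of_le_of_ne (by linarith [Finset.sum_nonneg hnonneg]) (hne k hk).symm
  have hother : ∀ j ∈ S, j ≠ k → v j < l := fun j hj hjk => by
    have hpair := Finset.add_le_sum hnonneg hk hj hjk.symm
    exact lt_of_le_of_ne
      (by linarith [le_max_left (v k - l) 0, le_max_left (v j - l) 0]) (hne j hj)
  constructor
  · intro hmax
    rcases eq_or_ne i k with rfl | hik
    · exact hlk
    · exact hlk.trans (hmax k hk hik.symm)
  · intro hli j hj hji
    have hik : i = k := by_contra fun hik => (hother i hi hik).not_gt hli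
    exact (hother j hj (hik ▸ hji)).trans hli

end Pointwise

section Duality

variable {n : ℕ} {F : Fin n → Measure ℝ} {ν : Fin n → ℝ} {S : Finset (Fin n)}
  {θ : Measure (Fin n → ℝ)}

/-- The value at the multiplier `l` of the dual of the transport problem of maximizing the expected
utility of `S` over the joint laws with marginals `F`. -/
noncomputable def dualValue (F : Fin n → Measure ℝ) (ν : Fin n → ℝ) (S : Finset (Fin n))
    (l : ℝ) : ℝ :=
  l + ∑ i ∈ S, ∫ t, max (ν i + t - l) 0 ∂F i

section Integrable

variable (hF : ∀ i, Integrable (fun t => t) (F i)) (hθ : θ ∈ jointLaws F)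
include hF hθ

lemma integrable_utility (i : Fin n) : Integrable (fun e => ν i + e i) θ := by
  have := hθ.1
  have hmarg : Integrable (fun t => t) (θ.map fun e => e i) := hθ.2 i ▸ hF i
  exact (integrable_const (ν i)).add (hmarg.comp_measurable (measurable_pi_apply i))

lemma integrable_posPart (i : Fin n) (l : ℝ) :
    Integrable (fun e => max (ν i + e i - l) 0) θ := by
  have := hθ.1
  exact ((integrable_utility hF hθ i).sub (integrable_const l)).pos_part

lemma integrable_add_sum_posPart (l : ℝ) :
    Integrable (fun e => l + ∑ i ∈ S, max (ν i + e i - l) 0) θ := by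
  have := hθ.1
  exact (integrable_const l).add (integrable_finsetSum S fun i _ => integrable_posPart hF hθ i l)

lemma integral_add_sum_posPart (l : ℝ) :
    ∫ e, (l + ∑ i ∈ S, max (ν i + e i - l) 0) ∂θ = dualValue F ν S l := by
  have := hθ.1
  rw [integral_add (integrable_const l)
    (integrable_finsetSum S fun i _ => integrable_posPart hF hθ i l),
    integral_finsetSum S fun i _ => integrable_posPart hF hθ i l, integral_const,
    probReal_univ, one_smul, dualValue]
  congr 1
  refine Finset.sum_congr rfl fun i _ => ?_
  rw [← hθ.2 i, integral_map (measurable_pi_apply i).aemeasurable]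
  exact (by fun_prop : Continuous fun t : ℝ => max (ν i + t - l) 0).aestronglyMeasurable

lemma integrable_iSup_utility (hS : S.Nonempty) :
    Integrable (fun e : Fin n → ℝ => ⨆ i : S, (ν i + e i)) θ := by
  have : Nonempty S := hS.to_subtype
  have hsum : Integrable (fun e => ∑ i ∈ S, |ν i + e i|) θ :=
    integrable_finsetSum S fun i _ => (integrable_utility hF hθ i).abs
  refine hsum.mono' (Measurable.iSup fun i => by fun_prop).aestronglyMeasurable
    (.of_forall fun e => ?_)
  obtain ⟨k, hk⟩ := exists_eq_ciSup_of_finite (f := fun i : S => ν i + e i)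
  rw [← hk, Real.norm_eq_abs]
  exact Finset.single_le_sum (f := fun i => |ν i + e i|) (fun j _ => abs_nonneg _) k.2

lemma expectedUtility_le_dualValue (hS : S.Nonempty) (l : ℝ) :
    expectedUtility ν S θ ≤ dualValue F ν S l := by
  rw [← integral_add_sum_posPart hF hθ l]
  exact integral_mono (integrable_iSup_utility hF hθ hS) (integrable_add_sum_posPart hF hθ l)
    fun e => iSup_le_add_sum_posPart S (fun i => ν i + e i) l hS

end Integrable

lemma ae_ne [∀ i, NullSingletonClass (F i)] (hθ : θ ∈ jointLaws F) (l : ℝ) :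
    ∀ᵐ e ∂θ, ∀ i, ν i + e i ≠ l := by
  refine ae_all_iff.2 fun i => ?_
  have hmarg : ∀ᵐ t ∂(θ.map fun e => e i), t ≠ l - ν i := by
    rw [hθ.2 i]
    exact Measure.ae_ne (F i) _
  filter_upwards [ae_of_ae_map (measurable_pi_apply i).aemeasurable hmarg] with e he hl
  exact he (by linarith)

lemma choiceProb_eq_of_expectedUtility_eq [∀ i, NullSingletonClass (F i)]
    (hF : ∀ i, Integrable (fun t => t) (F i)) (hθ : θ ∈ jointLaws F) {l : ℝ}
    (h : expectedUtility ν S θ = dualValue F ν S l) {i : Fin n} (hi : i ∈ S) :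
    choiceProb ν S θ i = (F i).real (Set.Ioi (l - ν i)) := by
  have hS : S.Nonempty := ⟨i, hi⟩
  have hae : ∀ᵐ e ∂θ, (⨆ i : S, (ν i + e i)) = l + ∑ i ∈ S, max (ν i + e i - l) 0 :=
    (integral_eq_iff_of_ae_le (integrable_iSup_utility hF hθ hS)
      (integrable_add_sum_posPart hF hθ l)
      (.of_forall fun e => iSup_le_add_sum_posPart S (fun i => ν i + e i) l hS)).1
      (h.trans (integral_add_sum_posPart hF hθ l).symm)
  have hset : {e : Fin n → ℝ | ∀ j ∈ S, j ≠ i → ν j + e j < ν i + e i} =ᵐ[θ]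
      (fun e : Fin n → ℝ => e i) ⁻¹' Set.Ioi (l - ν i) := by
    refine Filter.eventuallyEq_set.2 ?_
    filter_upwards [hae, ae_ne hθ l] with e he hne
    exact (isStrictMax_iff_lt_of_iSup_eq (v := fun i => ν i + e i) he (fun i _ => hne i) hi).trans
      sub_lt_iff_lt_add'.symm
  rw [choiceProb, measureReal_congr hset, ← hθ.2 i,
    map_measureReal_apply (measurable_pi_apply i) measurableSet_Ioi]

end Duality

section Coupling

open ProbabilityTheory

variable {ι : Type*} {Ω : ι → Type*} [∀ i, MeasurableSpace (Ω i)] {F : ∀ i, Measure (Ω i)}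
  {A : ∀ i, Set (Ω i)}

section Marginal

variable [DecidableEq ι]

/-- The marginal laws of the exclusive coupling of the events `A j`, conditionally on `A i` being
the event that occurs. -/
noncomputable def exclusiveMarginal (F : ∀ i, Measure (Ω i)) (A : ∀ i, Set (Ω i)) (i j : ι) :
    Measure (Ω j) :=
  (F j)[|if j = i then A j else (A j)ᶜ]

variable [Fintype ι]

/-- A coupling of the laws `F j` under which exactly one of the events `A i` occurs, provided
that the probabilities of these events add up to one: select `i` with probability `F i (A i)`,
then draw the coordinates independently, conditionally on `A i` and on the complements of the
other events. -/
noncomputable def exclusiveCoupling (F : ∀ i, Measure (Ω i)) (A : ∀ i, Set (Ω i)) :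
    Measure (∀ i, Ω i) :=
  ∑ i, F i (A i) • Measure.pi (exclusiveMarginal F A i)

variable [∀ i, IsProbabilityMeasure (F i)] (hA : ∀ i, MeasurableSet (A i))
  (hsum : ∑ i, F i (A i) = 1)
include hA hsum

lemma sum_erase_eq_measure_compl (j : ι) :
    ∑ i ∈ Finset.univ.erase j, F i (A i) = F j (A j)ᶜ := by
  rw [prob_compl_eq_one_sub (hA j), ← hsum, ← Finset.add_sum_erase _ _ (Finset.mem_univ j),
    ENNReal.add_sub_cancel_left (measure_ne_top _ _)]

lemma isProbabilityMeasure_exclusiveMarginal {i : ι} (hi : F i (A i) ≠ 0) (j : ι) :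
    IsProbabilityMeasure (exclusiveMarginal F A i j) := by
  refine cond_isProbabilityMeasure ?_
  split_ifs with hji
  · rwa [hji]
  · rw [← sum_erase_eq_measure_compl hA hsum j]
    exact fun h => hi (Finset.sum_eq_zero_iff.1 h i (by simp [Ne.symm hji]))

lemma sum_smul_exclusiveMarginal (j : ι) :
    ∑ i, F i (A i) • exclusiveMarginal F A i j = F j := by
  have hother : ∀ i ∈ Finset.univ.erase j,
      F i (A i) • exclusiveMarginal F A i j = F i (A i) • (F j)[|(A j)ᶜ] := fun i hi => by
    rw [exclusiveMarginal, if_neg (Finset.ne_of_mem_erase hi).symm]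
  rw [← Finset.add_sum_erase _ _ (Finset.mem_univ j), Finset.sum_congr rfl hother,
    ← Finset.sum_smul, sum_erase_eq_measure_compl hA hsum, exclusiveMarginal, if_pos rfl]
  ext s -
  simpa only [Measure.add_apply, Measure.smul_apply, smul_eq_mul, mul_comm] using
    cond_add_cond_compl_eq (hA j) (F j)

lemma map_eval_exclusiveCoupling (j : ι) :
    (exclusiveCoupling F A).map (fun e => e j) = F j := by
  rw [exclusiveCoupling, Measure.map_finset_sum (measurable_pi_apply j).aemeasurable]
  refine (Finset.sum_congr rfl fun i _ => ?_).trans (sum_smul_exclusiveMarginal hA hsum j)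
  rw [Measure.map_smul]
  rcases eq_or_ne (F i (A i)) 0 with h0 | h0
  · simp only [h0, zero_smul]
  · have := isProbabilityMeasure_exclusiveMarginal hA hsum h0
    congr 1
    exact (measurePreserving_eval (exclusiveMarginal F A i) j).map_eq

lemma ae_existsUnique_mem_exclusiveCoupling :
    ∀ᵐ e ∂exclusiveCoupling F A, ∃! i, e i ∈ A i := by
  rw [exclusiveCoupling, ae_finsetSum_measure_iff]
  intro i _
  rcases eq_or_ne (F i (A i)) 0 with h0 | h0
  · simp only [h0, zero_smul, ae_zero, Filter.eventually_bot]
  have := isProbabilityMeasure_exclusiveMarginal hA hsum h0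
  have hcoord : ∀ᵐ e ∂Measure.pi (exclusiveMarginal F A i),
      ∀ j, e j ∈ if j = i then A j else (A j)ᶜ :=
    ae_all_iff.2 fun j =>
      (measurePreserving_eval (exclusiveMarginal F A i) j).quasiMeasurePreserving.ae
        (ae_cond_mem (by split_ifs; exacts [hA j, (hA j).compl]))
  refine Measure.ae_smul_measure ?_ _
  filter_upwards [hcoord] with e he
  refine ⟨i, by simpa using he i, fun j hj => by_contra fun hji => ?_⟩
  exact (by simpa only [if_neg hji] using he j : e j ∈ (A j)ᶜ) hj

end Marginal

lemma exists_exclusive_coupling [Fintype ι] [∀ i, IsProbabilityMeasure (F i)]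
    (hA : ∀ i, MeasurableSet (A i)) (hsum : ∑ i, F i (A i) = 1) :
    ∃ θ : Measure (∀ i, Ω i), IsProbabilityMeasure θ ∧ (∀ j, θ.map (fun e => e j) = F j) ∧
      ∀ᵐ e ∂θ, ∃! i, e i ∈ A i := by
  classical
  obtain ⟨j, -⟩ : ∃ j ∈ Finset.univ, F j (A j) ≠ 0 :=
    Finset.exists_ne_zero_of_sum_ne_zero (by rw [hsum]; exact one_ne_zero)
  have hmap := map_eval_exclusiveCoupling hA hsum
  refine ⟨exclusiveCoupling F A, ?_, hmap, ae_existsUnique_mem_exclusiveCoupling hA hsum⟩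
  have : IsProbabilityMeasure ((exclusiveCoupling F A).map fun e => e j) := by
    rw [hmap j]; infer_instance
  exact Measure.isProbabilityMeasure_of_map (fun e => e j)

end Coupling

section ExtremalLaw

open ProbabilityTheory Filter Topology

lemma real_Ioi_eq_one_sub_cdf (μ : Measure ℝ) [IsProbabilityMeasure μ] (a : ℝ) :
    μ.real (Set.Ioi a) = 1 - cdf μ a := by
  rw [cdf_eq_real, ← Set.compl_Iic, probReal_compl_eq_one_sub measurableSet_Iic]

lemma continuous_cdf (μ : Measure ℝ) [IsProbabilityMeasure μ] [NullSingletonClass μ] :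
    Continuous (cdf μ) := by
  refine continuous_iff_continuousAt.2 fun a => ?_
  rw [(cdf μ).mono.continuousAt_iff_leftLim_eq_rightLim, StieltjesFunction.rightLim_eq]
  have hjump : ENNReal.ofReal (cdf μ a - Function.leftLim (cdf μ) a) = 0 := by
    rw [← (cdf μ).measure_singleton, measure_cdf, measure_singleton]
  exact le_antisymm ((cdf μ).mono.leftLim_le le_rfl) (sub_nonpos.1 (ENNReal.ofReal_eq_zero.1 hjump))

lemma IsMarginal.nullSingletonClass {μ : Measure ℝ} (hμ : IsMarginal μ) : NullSingletonClass μ :=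
  ⟨fun _ => hμ.absolutelyContinuous Real.volume_singleton⟩

variable {n : ℕ} {F : Fin n → Measure ℝ} {ν : Fin n → ℝ} {S : Finset (Fin n)}

lemma exists_sum_real_Ioi_eq_one [∀ i, IsProbabilityMeasure (F i)]
    [∀ i, NullSingletonClass (F i)] (hS : 1 < S.card) :
    ∃ l : ℝ, ∑ i ∈ S, (F i).real (Set.Ioi (l - ν i)) = 1 := by
  simp only [real_Ioi_eq_one_sub_cdf]
  have hcont : Continuous fun l : ℝ => ∑ i ∈ S, (1 - cdf (F i) (l - ν i)) :=
    continuous_finsetSum S fun i _ =>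
      continuous_const.sub ((continuous_cdf (F i)).comp (by fun_prop))
  have hbot : Tendsto (fun l : ℝ => ∑ i ∈ S, (1 - cdf (F i) (l - ν i))) atBot
      (𝓝 (∑ i ∈ S, (1 - 0))) :=
    tendsto_finsetSum S fun i _ => tendsto_const_nhds.sub
      ((tendsto_cdf_atBot (F i)).comp (tendsto_atBot_add_const_right _ _ tendsto_id))
  have htop : Tendsto (fun l : ℝ => ∑ i ∈ S, (1 - cdf (F i) (l - ν i))) atTop
      (𝓝 (∑ i ∈ S, (1 - 1))) :=
    tendsto_finsetSum S fun i _ => tendsto_const_nhds.sub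
      ((tendsto_cdf_atTop (F i)).comp (tendsto_atTop_add_const_right _ _ tendsto_id))
  obtain ⟨a, ha⟩ := (hbot.eventually_const_lt (u := (1 : ℝ)) (by simpa using hS)).exists
  obtain ⟨b, hb⟩ := (htop.eventually_lt_const (u := (1 : ℝ)) (by simp)).exists
  exact mem_range_of_exists_le_of_exists_ge hcont ⟨b, hb.le⟩ ⟨a, ha.le⟩

section Multiplier

variable [∀ i, IsProbabilityMeasure (F i)] (hF : ∀ i, Integrable (fun t => t) (F i))
include hF

lemma exists_expectedUtility_eq_dualValue {l : ℝ}
    (hl : ∑ i ∈ S, (F i).real (Set.Ioi (l - ν i)) = 1) :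
    ∃ θ ∈ jointLaws F, expectedUtility ν S θ = dualValue F ν S l := by
  let A : Fin n → Set ℝ := fun i => if i ∈ S then Set.Ioi (l - ν i) else ∅
  have hA : ∀ i, MeasurableSet (A i) := fun i => by
    dsimp only [A]; split_ifs; exacts [measurableSet_Ioi, .empty]
  have hsum : ∑ i, F i (A i) = 1 := by
    simp only [A, apply_ite (F _), measure_empty, Finset.sum_ite_mem, Finset.univ_inter]
    rw [← ENNReal.toReal_eq_one_iff, ENNReal.toReal_sum fun _ _ => measure_ne_top _ _]
    exact hl
  obtain ⟨θ, hθ, hmap, hae⟩ := exists_exclusive_coupling hA hsum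
  refine ⟨θ, ⟨hθ, hmap⟩, ?_⟩
  rw [← integral_add_sum_posPart hF ⟨hθ, hmap⟩ l]
  refine integral_congr_ae ?_
  filter_upwards [hae] with e ⟨i, hi, huniq⟩
  have hmem : ∀ j ∈ S, e j ∈ A j ↔ l < ν j + e j := fun j hj => by
    simp only [A, if_pos hj, Set.mem_Ioi, sub_lt_iff_lt_add']
  have hiS : i ∈ S := by_contra fun h => by simp [A, h] at hi
  exact iSup_eq_add_sum_posPart (v := fun i => ν i + e i) hiS ((hmem i hiS).1 hi)
    fun j hj hji => not_lt.1 fun hlt => hji (huniq j ((hmem j hj).2 hlt))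

variable [∀ i, NullSingletonClass (F i)]

lemma exists_isExtremal {l : ℝ} (hl : ∑ i ∈ S, (F i).real (Set.Ioi (l - ν i)) = 1) :
    ∃ θ, IsExtremal F ν S θ ∧
      ∀ i ∈ S, choiceProb ν S θ i = (F i).real (Set.Ioi (l - ν i)) := by
  have hS : S.Nonempty := Finset.nonempty_of_sum_ne_zero (hl ▸ one_ne_zero)
  obtain ⟨θ, hθ, h⟩ := exists_expectedUtility_eq_dualValue hF hl
  exact ⟨θ, ⟨hθ, fun θ' hθ' => (expectedUtility_le_dualValue hF hθ' hS l).trans h.ge⟩,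
    fun i hi => choiceProb_eq_of_expectedUtility_eq hF hθ h hi⟩

lemma IsExtremal.choiceProb_eq {θ : Measure (Fin n → ℝ)} (hθ : IsExtremal F ν S θ) {l : ℝ}
    (hl : ∑ i ∈ S, (F i).real (Set.Ioi (l - ν i)) = 1) {i : Fin n} (hi : i ∈ S) :
    choiceProb ν S θ i = (F i).real (Set.Ioi (l - ν i)) := by
  obtain ⟨θ', hθ', h⟩ := exists_expectedUtility_eq_dualValue hF hl
  exact choiceProb_eq_of_expectedUtility_eq hF hθ.1
    ((expectedUtility_le_dualValue hF hθ.1 ⟨i, hi⟩ l).antisymm (h.ge.trans (hθ.2 hθ'))) hi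

-- The multiplier `⊥` serves the singletons, whose product is chosen almost surely although its
-- tail probability at a real multiplier may be smaller than one.
lemma IsExtremal.exists_multiplier {θ : Measure (Fin n → ℝ)} (hθ : IsExtremal F ν S θ)
    (hS : S.Nonempty) :
    ∃ l : WithBot ℝ,
      (∀ i ∈ S, choiceProb ν S θ i = (F i).real {t | l < ((ν i + t : ℝ) : WithBot ℝ)}) ∧
        ∑ i ∈ S, choiceProb ν S θ i = 1 := by
  have := hθ.1.1
  rcases (Finset.one_le_card.2 hS).eq_or_lt with hcard | hcard
  · obtain ⟨i, rfl⟩ := Finset.card_eq_one.1 hcard.symm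
    have hi : choiceProb ν {i} θ i = 1 := by simp [choiceProb]
    exact ⟨⊥, by simp [hi], by simp [hi]⟩
  · obtain ⟨l, hl⟩ := exists_sum_real_Ioi_eq_one (F := F) (ν := ν) hcard
    have hchoice := fun i hi => hθ.choiceProb_eq hF hl (i := i) hi
    refine ⟨l, fun i hi => ?_, (Finset.sum_congr rfl hchoice).trans hl⟩
    rw [hchoice i hi]
    congr 1
    ext t
    simp only [Set.mem_Ioi, Set.mem_ofPred_eq, WithBot.coe_lt_coe, sub_lt_iff_lt_add']

end Multiplier

end ExtremalLaw

section InterpolatingMarginal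

open ProbabilityTheory Set

lemma isMarginal_of_ae_eq_ae_restrict_Ioc {μ : Measure ℝ} [IsProbabilityMeasure μ] {a b : ℝ}
    (hμ : ae μ = ae (volume.restrict (Ioc a b))) : IsMarginal μ := by
  have hac : μ ≪ volume.restrict (Ioc a b) := Measure.ae_le_iff_absolutelyContinuous.1 hμ.le
  have hca : volume.restrict (Ioc a b) ≪ μ := Measure.ae_le_iff_absolutelyContinuous.1 hμ.ge
  have hae : ∀ᵐ t ∂μ, t ∈ Icc a b :=
    hac.ae_le ((ae_restrict_mem measurableSet_Ioc).mono fun t ht => Ioc_subset_Icc_self ht)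
  have hsupp : μ.support ⊆ Icc a b := Measure.support_subset_of_isClosed isClosed_Icc hae
  refine ⟨inferInstance, hac.trans Measure.absolutelyContinuous_restrict, fun x hx y hy hxy => ?_,
    Integrable.of_mem_Icc a b aemeasurable_id hae⟩
  have hpos : μ (Ioc x y) ≠ 0 := fun h0 => by
    have hvol := hca h0
    rw [Measure.restrict_apply measurableSet_Ioc, inter_eq_left.2
      (Ioc_subset_Ioc (hsupp hx).1 (hsupp hy).2), Real.volume_Ioc, ENNReal.ofReal_eq_zero] at hvol
    linarith
  rwa [← measure_cdf μ, StieltjesFunction.measure_Ioc, Ne, ENNReal.ofReal_eq_zero, not_le,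
    sub_pos] at hpos

lemma exists_measure_extend_left {μ : Measure ℝ} {m a b : ℝ} (hma : m < a) (hab : a ≤ b)
    (hμ : ae μ = ae (volume.restrict (Ioc a b))) {w : ℝ≥0∞} (hw : w ≠ 0) :
    ∃ μ' : Measure ℝ, ae μ' = ae (volume.restrict (Ioc m b)) ∧
      (∀ q, a ≤ q → μ' (Ioi q) = μ (Ioi q)) ∧ μ' (Ioi m) = μ (Ioi a) + w := by
  have hprob : IsProbabilityMeasure (volume[|Ioc m a]) :=
    cond_isProbabilityMeasure_of_finite (by simpa using hma) (by simp)
  have hcond : ∀ᵐ t ∂volume[|Ioc m a], t ∈ Ioc m a := ae_cond_mem measurableSet_Ioc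
  have hlt : ∀ᵐ t ∂μ, a < t := by
    rw [hμ]
    exact (ae_restrict_mem measurableSet_Ioc).mono fun t ht => ht.1
  have hae : ae (volume[|Ioc m a]) = ae (volume.restrict (Ioc m a)) :=
    Measure.ae_ennreal_smul_measure_eq (by simp) _
  have hadd : ae (μ + w • volume[|Ioc m a]) = ae μ ⊔ ae (w • volume[|Ioc m a]) :=
    Filter.ext fun s => ae_add_measure_iff
  refine ⟨μ + w • volume[|Ioc m a], ?_, fun q hq => ?_, ?_⟩
  · rw [hadd, Measure.ae_ennreal_smul_measure_eq hw, hμ, hae, sup_comm, ← ae_restrict_union_eq,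
      Ioc_union_Ioc_eq_Ioc hma.le hab]
  · have hnull : volume[|Ioc m a] (Ioi q) = 0 :=
      measure_eq_zero_iff_ae_notMem.2 (hcond.mono fun t ht => (ht.2.trans hq).not_gt)
    rw [Measure.add_apply, Measure.smul_apply, hnull, smul_zero, add_zero]
  · have hone : volume[|Ioc m a] (Ioi m) = 1 :=
      (mem_ae_iff_prob_eq_one measurableSet_Ioi).1 (hcond.mono fun t ht => ht.1)
    have htail : μ (Ioi m) = μ (Ioi a) := measure_congr <| Filter.eventuallyEq_set.2 <|
      hlt.mono fun t ht => iff_of_true (hma.trans ht) ht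
    rw [Measure.add_apply, Measure.smul_apply, hone, htail, smul_eq_mul, mul_one]

lemma exists_measure_Ioi_eq (s : Finset ℝ) {m : ℝ} (hm : ∀ q ∈ s, m < q) {z : ℝ → ℝ}
    (hanti : StrictAntiOn z (insert m s)) (hz : ∀ q ∈ insert m s, 0 < z q) :
    ∃ (μ : Measure ℝ) (b : ℝ), m < b ∧ ae μ = ae (volume.restrict (Ioc m b)) ∧
      ∀ q ∈ insert m s, μ (Ioi q) = ENNReal.ofReal (z q) := by
  induction s using Finset.induction_on_min generalizing m with
  | empty =>
    obtain ⟨μ, hμ, -, htail⟩ := exists_measure_extend_left (μ := 0) (lt_add_one m) le_rfl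
      (by simp) (ENNReal.ofReal_pos.2 (hz m (by simp))).ne'
    exact ⟨μ, m + 1, lt_add_one m, hμ, by simpa using htail⟩
  | insert a s ha ih =>
    have hma : m < a := hm a (by simp)
    have hsub : insert a (s : Set ℝ) ⊆ insert m (insert a s : Finset ℝ) := by simp
    obtain ⟨μ, b, hab, hμ, htail⟩ := ih ha (hanti.mono hsub)
      fun q hq => hz q (Finset.mem_insert_of_mem hq)
    have hzma : z a < z m := hanti (by simp) (by simp) hma
    have hza : 0 < z a := hz a (by simp)
    obtain ⟨μ', hμ', htail', hmass⟩ := exists_measure_extend_left hma hab.le hμ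
      (ENNReal.ofReal_pos.2 (sub_pos.2 hzma)).ne'
    refine ⟨μ', b, hma.trans hab, hμ', (Finset.forall_mem_insert ..).2 ⟨?_, fun q hq => ?_⟩⟩
    · rw [hmass, htail a (by simp), ← ENNReal.ofReal_add hza.le (sub_pos.2 hzma).le,
        add_sub_cancel]
    · have haq : a ≤ q := (Finset.mem_insert.1 hq).elim (fun h => h.ge) fun h => (ha q h).le
      rw [htail' q haq, htail q hq]

lemma exists_isMarginal_of_eq_one (s : Finset ℝ) {m : ℝ} (hm : ∀ q ∈ s, m < q) {z : ℝ → ℝ}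
    (hanti : StrictAntiOn z (insert m s)) (hz : ∀ q ∈ insert m s, 0 < z q) (hone : z m = 1) :
    ∃ μ, IsMarginal μ ∧ ∀ q ∈ insert m s, μ.real (Ioi q) = z q := by
  obtain ⟨μ, b, -, hμ, htail⟩ := exists_measure_Ioi_eq s hm hanti hz
  have hlt : ∀ᵐ t ∂μ, m < t := by
    rw [hμ]
    exact (ae_restrict_mem measurableSet_Ioc).mono fun t ht => ht.1
  have hprob : IsProbabilityMeasure μ := ⟨by
    rw [← measure_congr (Filter.eventuallyEq_univ.2 hlt), ← ENNReal.ofReal_one, ← hone]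
    exact htail m (by simp)⟩
  exact ⟨μ, isMarginal_of_ae_eq_ae_restrict_Ioc hμ, fun q hq => by
    rw [measureReal_def, htail q hq, ENNReal.toReal_ofReal (hz q hq).le]⟩

lemma exists_isMarginal_of_strictAntiOn (s : Finset ℝ) {z : ℝ → ℝ} (hanti : StrictAntiOn z s)
    (hz : ∀ q ∈ s, z q ∈ Ioc 0 1) :
    ∃ μ, IsMarginal μ ∧ ∀ q ∈ s, μ.real (Ioi q) = z q := by
  by_cases hone : ∃ m ∈ s, z m = 1
  · obtain ⟨m, hms, hm⟩ := hone
    have hlt : ∀ q ∈ s.erase m, m < q := fun q hq => by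
      obtain ⟨hqm, hqs⟩ := Finset.mem_erase.1 hq
      exact (hanti.le_iff_ge hqs hms).1 (hm ▸ (hz q hqs).2) |>.lt_of_ne hqm.symm
    have hins : insert m (s.erase m) = s := Finset.insert_erase hms
    rw [← hins]
    exact exists_isMarginal_of_eq_one (s.erase m) hlt (by rwa [← Finset.coe_insert, hins])
      (hins.symm ▸ fun q hq => (hz q hq).1) hm
  · push Not at hone
    obtain ⟨m, hm⟩ : ∃ m, ∀ q ∈ s, m < q :=
      ((Filter.eventually_all_finset s).2 fun q _ => Filter.eventually_lt_atBot q).exists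
    have hupd : EqOn z (Function.update z m 1) s := fun q hq =>
      (Function.update_of_ne (hm q hq).ne' _ _).symm
    have hlt : ∀ q ∈ s, Function.update z m 1 q < Function.update z m 1 m := fun q hq => by
      rw [← hupd hq, Function.update_self]
      exact (hz q hq).2.lt_of_ne (hone q hq)
    obtain ⟨μ, hμ, htail⟩ := exists_isMarginal_of_eq_one s hm
      ((strictAntiOn_insert_iff_of_forall_ge fun q hq => (hm q hq).le).2
        ⟨fun q hq _ => hlt q hq, hanti.congr hupd⟩)
      ((Finset.forall_mem_insert ..).2 ⟨by simp, fun q hq => hupd hq ▸ (hz q hq).1⟩) (by simp)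
    exact ⟨μ, hμ, fun q hq => (htail q (Finset.mem_insert_of_mem hq)).trans (hupd hq).symm⟩

lemma exists_isMarginal_real_Ioi_eq {ι : Type*} [Finite ι] {q z : ι → ℝ}
    (hqz : ∀ i j, z j ≤ z i ↔ q i ≤ q j) (hz : ∀ i, z i ∈ Ioc 0 1) :
    ∃ μ, IsMarginal μ ∧ ∀ i, μ.real (Ioi (q i)) = z i := by
  have := Fintype.ofFinite ι
  have hext : ∀ i, Function.extend q z 0 (q i) = z i :=
    Function.FactorsThrough.extend_apply (fun i j hij =>
      ((hqz j i).2 hij.ge).antisymm ((hqz i j).2 hij.le)) 0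
  obtain ⟨μ, hμ, htail⟩ := exists_isMarginal_of_strictAntiOn (Finset.univ.image q)
    (z := Function.extend q z 0) (by
      simp only [Finset.coe_image, Finset.coe_univ, image_univ]
      rintro _ ⟨i, rfl⟩ _ ⟨j, rfl⟩ hij
      rw [hext, hext]
      exact lt_of_not_ge fun h => hij.not_ge ((hqz j i).1 h)) (by simpa [hext] using hz)
  exact ⟨μ, hμ, fun i => (htail _ (by simp)).trans (hext i)⟩

end InterpolatingMarginal

section Ranking

variable {n : ℕ} {𝒮 : Finset (Finset (Fin n))} {α β : Type*}

/-- The multipliers `l` rank the assortments consistently with the choice probabilities `x`: a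
product common to two assortments is chosen at most as often from the one with the larger
multiplier. -/
def AntitoneIn [LE α] (x : ChoiceVec 𝒮) (l : 𝒮 → α) : Prop :=
  ∀ (S T : 𝒮) (i : Fin n) (hS : i ∈ S.1) (hT : i ∈ T.1), l S ≤ l T → x T ⟨i, hT⟩ ≤ x S ⟨i, hS⟩

/-- The strict version of `AntitoneIn`: moreover the choice probabilities of a common product are
equal only at equal multipliers. -/
def StrictAntiIn [LE α] (x : ChoiceVec 𝒮) (l : 𝒮 → α) : Prop :=
  ∀ (S T : 𝒮) (i : Fin n) (hS : i ∈ S.1) (hT : i ∈ T.1), x T ⟨i, hT⟩ ≤ x S ⟨i, hS⟩ ↔ l S ≤ l T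

variable (𝒮) in
/-- The choice vectors that are ranked by some multipliers; this set is closed and contains the
representable ones as a subset over which the infimum of the loss is the same. -/
def rankable : Set (ChoiceVec 𝒮) :=
  {x | (∀ S, x S ∈ stdSimplex ℝ S.1) ∧ ∃ l : 𝒮 → ℝ, AntitoneIn x l}

lemma AntitoneIn.of_le_imp_le [LE α] [LE β] {x : ChoiceVec 𝒮} {l : 𝒮 → α} {l' : 𝒮 → β}
    (h : AntitoneIn x l) (hl : ∀ S T, l' S ≤ l' T → l S ≤ l T) : AntitoneIn x l' :=
  fun S T i hS hT hST => h S T i hS hT (hl S T hST)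

lemma exists_rank [LinearOrder α] {ι : Type*} [Fintype ι] (v : ι → α) :
    ∃ r : ι → Fin (Fintype.card ι), ∀ i j, r i ≤ r j ↔ v i ≤ v j := by
  have hcard : ∀ i, (Finset.univ.filter fun k => v k < v i).card < Fintype.card ι := fun i =>
    Finset.card_lt_univ_of_notMem (x := i) (by simp)
  refine ⟨fun i => ⟨_, hcard i⟩, fun i j => ⟨fun h => ?_, fun h => ?_⟩⟩
  · by_contra! hji
    refine h.not_gt (Finset.card_lt_card (Finset.ssubset_iff_of_subset ?_ |>.2 ⟨j, ?_⟩))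
    · exact Finset.monotone_filter_right _ fun k _ hk => hk.trans hji
    · simpa using hji
  · exact Finset.card_le_card (Finset.monotone_filter_right _ fun k _ hk => hk.trans_le h)

lemma AntitoneIn.exists_rank [LinearOrder α] {x : ChoiceVec 𝒮} {l : 𝒮 → α}
    (h : AntitoneIn x l) : ∃ r : 𝒮 → Fin (Fintype.card 𝒮), AntitoneIn x r :=
  (MDM.exists_rank l).imp fun _ hr => h.of_le_imp_le fun S T => (hr S T).1

lemma mem_rankable [LinearOrder α] {x : ChoiceVec 𝒮} (hx : ∀ S, x S ∈ stdSimplex ℝ S.1)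
    {l : 𝒮 → α} (h : AntitoneIn x l) : x ∈ rankable 𝒮 := by
  obtain ⟨r, hr⟩ := h.exists_rank
  exact ⟨hx, fun S => (r S : ℕ), hr.of_le_imp_le fun S T hST => by exact_mod_cast hST⟩

lemma isCompact_rankable : IsCompact (rankable 𝒮) := by
  have hunion : rankable 𝒮 = ⋃ r : 𝒮 → Fin (Fintype.card 𝒮),
      (Set.univ.pi fun S : 𝒮 => stdSimplex ℝ S.1) ∩ {x | AntitoneIn x r} := by
    ext x
    simp only [Set.mem_iUnion, Set.mem_inter_iff, Set.mem_univ_pi, Set.mem_ofPred_eq]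
    exact ⟨fun ⟨hx, l, hl⟩ => hl.exists_rank.imp fun r hr => ⟨hx, hr⟩,
      fun ⟨r, hx, hr⟩ => mem_rankable hx hr⟩
  have hclosed : ∀ r : 𝒮 → Fin (Fintype.card 𝒮), IsClosed {x | AntitoneIn x r} := fun r => by
    simp only [AntitoneIn, Set.ofPred_forall]
    exact isClosed_iInter fun S => isClosed_iInter fun T => isClosed_iInter fun i =>
      isClosed_iInter fun hS => isClosed_iInter fun hT => isClosed_iInter fun _ =>
        isClosed_le (by fun_prop) (by fun_prop)
  rw [hunion]
  exact isCompact_iUnion fun r =>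
    (isCompact_univ_pi fun S => isCompact_stdSimplex ℝ S.1).inter_right (hclosed r)

lemma rankable_nonempty (hne : ∀ S : 𝒮, S.1.Nonempty) : (rankable 𝒮).Nonempty := by
  refine ⟨fun S _ => (S.1.card : ℝ)⁻¹, mem_rankable (l := fun S => S.1.card) (fun S => ?_)
    fun S T i hS _ hST => ?_⟩
  · refine ⟨fun _ => by positivity, ?_⟩
    have : (S.1.card : ℝ) ≠ 0 := by exact_mod_cast (hne S).card_pos.ne'
    simp [this]
  · have : 0 < S.1.card := Finset.card_pos.2 ⟨i, hS⟩
    gcongr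

lemma representable_subset_rankable (hne : ∀ S : 𝒮, S.1.Nonempty) :
    representable 𝒮 ⊆ rankable 𝒮 := by
  rintro x ⟨F, ν, hF, hx⟩
  have := fun i => (hF i).isProbabilityMeasure
  have := fun i => (hF i).nullSingletonClass
  choose θ hθ hxθ using hx
  choose l hl hsum using fun S : 𝒮 =>
    (hθ S).exists_multiplier (fun i => (hF i).integrable) (hne S)
  refine mem_rankable (l := l) (fun S => ⟨fun i => ?_, ?_⟩) fun S T i hS hT hST => ?_
  · rw [hxθ]
    exact measureReal_nonneg
  · rw [← hsum S, ← Finset.sum_coe_sort S.1]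
    exact Finset.sum_congr rfl fun i _ => hxθ S i
  · rw [hxθ, hxθ, hl S i hS, hl T i hT]
    exact measureReal_mono fun t ht => hST.trans_lt ht

lemma IsFeasible.antitoneIn {ε : ℝ} {x : ChoiceVec 𝒮} {lam : 𝒮 → ℝ} {δ : 𝒮 → 𝒮 → ℝ}
    (h : IsFeasible ε x lam δ) (hε : 0 < ε) : AntitoneIn x lam := by
  intro S T i hS hT hST
  by_contra! hlt
  have htie := h.tie_upper T S i hT hS
  have hmono := h.mono_upper T S i hT hS
  have horder := h.order_upper T S i hT hS
  have hδST : δ S T = 0 := (h.binary S T).resolve_right fun hδ => by linarith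
  have hδTS : δ T S = 1 := (h.binary T S).resolve_left fun hδ => by linarith
  rw [hδTS] at horder
  linarith

lemma AntitoneIn.sub_le_ite [LinearOrder α] {x : ChoiceVec 𝒮}
    (hx : ∀ S, x S ∈ stdSimplex ℝ S.1) {l : 𝒮 → α} (h : AntitoneIn x l) (S T : 𝒮) (i : Fin n)
    (hS : i ∈ S.1) (hT : i ∈ T.1) :
    x S ⟨i, hS⟩ - x T ⟨i, hT⟩ ≤ if l S < l T then 1 else 0 := by
  split_ifs with hST
  · linarith [(mem_Icc_of_mem_stdSimplex (hx S) ⟨i, hS⟩).2, (hx T).1 ⟨i, hT⟩]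
  · linarith [h T S i hT hS (not_lt.1 hST)]

lemma isFeasible_of_antitoneIn {ε : ℝ} (hε : 0 ≤ ε) (hε' : ε * (𝒮.card - 1) ≤ 1)
    {x : ChoiceVec 𝒮} (hx : ∀ S, x S ∈ stdSimplex ℝ S.1) {r : 𝒮 → Fin (Fintype.card 𝒮)}
    (hr : AntitoneIn x r) :
    IsFeasible ε x (fun S => ε * (r S : ℕ)) fun S T => if r S < r T then 1 else 0 := by
  have hnonneg : ∀ S, 0 ≤ ε * (r S : ℕ) := fun S => by positivity
  have hle_one : ∀ S, ε * (r S : ℕ) ≤ 1 := fun S => by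
    refine (mul_le_mul_of_nonneg_left (le_sub_iff_add_le.2 ?_) hε).trans hε'
    exact_mod_cast (r S).isLt.trans_eq (Fintype.card_coe 𝒮)
  have hgap : ∀ S T, r S < r T → ε * (r S : ℕ) + ε ≤ ε * (r T : ℕ) := fun S T hST => by
    rw [← mul_add_one]
    exact mul_le_mul_of_nonneg_left (by exact_mod_cast hST) hε
  have hmono : ∀ S T, r T ≤ r S → ε * (r T : ℕ) ≤ ε * (r S : ℕ) := fun S T hTS =>
    mul_le_mul_of_nonneg_left (by exact_mod_cast hTS) hε
  have hδ : ∀ S T, (if r S < r T then 1 else 0 : ℝ) + (if r T < r S then 1 else 0) ≤ 1 :=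
    fun S T => by rcases lt_trichotomy (r S) (r T) with h | h | h <;> simp [h, h.not_gt]
  have hδ_nonneg : ∀ S T, (0 : ℝ) ≤ if r S < r T then 1 else 0 := fun S T => by
    split_ifs <;> norm_num
  have hsub := hr.sub_le_ite hx
  refine ⟨fun S T i _ _ => ?_, fun S T i _ _ => ?_, fun S T i hS hT => ?_,
    fun S T i hS hT => ?_, fun S T i hS hT => ?_, fun S T i hS hT => ?_, fun S => (hx S).2,
    fun S => (hx S).1, hnonneg, hle_one, fun S T => (ite_eq_or_eq _ _ _).symm⟩
  · split_ifs with hST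
    · linarith [hnonneg S, hle_one T]
    · linarith [hmono S T (not_lt.1 hST)]
  · split_ifs with hST
    · linarith [hgap S T hST]
    · linarith [hle_one S, hnonneg T]
  · linarith [hsub T S i hT hS, hδ S T]
  · linarith [hsub S T i hS hT, hδ S T]
  · linarith [hsub T S i hT hS, hδ_nonneg S T]
  · linarith [hsub S T i hS hT, hδ_nonneg T S]

lemma feasibleValues_eq_image (loss : (S : 𝒮) → (S.1 → ℝ) → (S.1 → ℝ) → ℝ≥0∞)
    (p : ChoiceVec 𝒮) {ε : ℝ} (hε : 0 < ε) (hε' : ε * (𝒮.card - 1) ≤ 1) :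
    feasibleValues loss p ε = totalLoss loss p '' rankable 𝒮 := by
  ext v
  constructor
  · rintro ⟨x, lam, δ, h, rfl⟩
    exact ⟨x, mem_rankable (fun S => ⟨h.nonneg S, h.sum_eq_one S⟩) (h.antitoneIn hε), rfl⟩
  · rintro ⟨x, ⟨hx, l, hl⟩, rfl⟩
    obtain ⟨r, hr⟩ := hl.exists_rank
    exact ⟨x, _, _, isFeasible_of_antitoneIn hε.le hε' hx hr, rfl⟩

end Ranking

section Perturbation

open Filter Topology

lemma exists_continuous_antitone_eq {ι : Type*} [Finite ι] {a z : ι → ℝ}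
    (haz : ∀ i j, a i ≤ a j → z j ≤ z i) (hz : ∀ i, 0 ≤ z i) :
    ∃ G : ℝ → ℝ, Continuous G ∧ Antitone G ∧ (∀ t, 0 ≤ G t) ∧ ∀ i, G (a i) = z i := by
  rcases isEmpty_or_nonempty ι with hι | hι
  · exact ⟨0, continuous_const, antitone_const, fun _ => le_rfl, fun i => hι.elim i⟩
  have := Fintype.ofFinite ι
  obtain ⟨K, hK⟩ := (Set.finite_range fun p : ι × ι => (z p.1 - z p.2) / (a p.2 - a p.1)).bddAbove
  have hlip : ∀ i j, z i ≤ z j + max K 0 * max (a j - a i) 0 := fun i j => by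
    rcases le_or_gt (a j) (a i) with hji | hij
    · rw [max_eq_right (sub_nonpos.2 hji), mul_zero, add_zero]
      exact haz j i hji
    · have hslope := (div_le_iff₀ (sub_pos.2 hij)).1 (hK ⟨(i, j), rfl⟩)
      rw [max_eq_left (sub_pos.2 hij).le]
      linarith [mul_le_mul_of_nonneg_right (le_max_left K 0) (sub_pos.2 hij).le]
  -- McShane's extension, with the one-sided distance `max (a i - t) 0` so that it is antitone.
  refine ⟨fun t => Finset.univ.inf' Finset.univ_nonempty
      fun i => z i + max K 0 * max (a i - t) 0,
    Continuous.finset_inf'_apply _ fun i _ => by fun_prop,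
    fun s t hst => Finset.inf'_mono_fun fun i _ => ?_,
    fun t => Finset.le_inf' _ _ fun i _ => ?_, fun i => le_antisymm ?_ ?_⟩
  · gcongr
  · have := hz i
    positivity
  · exact (Finset.inf'_le _ (Finset.mem_univ i)).trans_eq (by simp)
  · exact Finset.le_inf' _ _ fun j _ => hlip i j

lemma abs_sub_le_abs_sum_sub_of_antitone {ι : Type*} [Fintype ι] {G : ι → ℝ → ℝ}
    (hG : ∀ i, Antitone (G i)) (i : ι) (s t : ℝ) :
    |G i s - G i t| ≤ |∑ j, G j s - ∑ j, G j t| := by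
  wlog hst : s ≤ t generalizing s t
  · rw [abs_sub_comm, abs_sub_comm (∑ j, G j s)]
    exact this t s (not_le.1 hst).le
  have hnonneg : ∀ j, 0 ≤ G j s - G j t := fun j => sub_nonneg.2 (hG j hst)
  rw [← Finset.sum_sub_distrib, abs_of_nonneg (hnonneg i),
    abs_of_nonneg (Finset.sum_nonneg fun j _ => hnonneg j)]
  exact Finset.single_le_sum (f := fun j => G j s - G j t) (fun j _ => hnonneg j)
    (Finset.mem_univ i)

lemma exists_mem_uIcc_convexCombo_eq {D H : ℝ → ℝ} (hD : Continuous D) (hD' : Antitone D)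
    (hH : Continuous H) (hH' : Antitone H) {a b c t : ℝ} (ha : D a = c) (hb : H b = c)
    (ht : t ∈ Set.Icc 0 1) : ∃ l ∈ Set.uIcc a b, (1 - t) * D l + t * H l = c := by
  have hcont : Continuous fun l => (1 - t) * D l + t * H l := by fun_prop
  refine intermediate_value_uIcc hcont.continuousOn (Set.mem_uIcc.2 ?_)
  have ht' : 0 ≤ 1 - t := sub_nonneg.2 ht.2
  rcases le_total a b with hab | hba
  · have hDb := mul_le_mul_of_nonneg_left (hD' hab) ht'
    have hHa := mul_le_mul_of_nonneg_left (hH' hab) ht.1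
    right
    constructor <;> simp only [ha, hb] at hDb hHa ⊢ <;> linarith
  · have hDb := mul_le_mul_of_nonneg_left (hD' hba) ht'
    have hHa := mul_le_mul_of_nonneg_left (hH' hba) ht.1
    left
    constructor <;> simp only [ha, hb] at hDb hHa ⊢ <;> linarith

lemma exists_sum_add_exp_eq_one {ι : Type*} [Fintype ι] {G : ι → ℝ → ℝ}
    (hG : ∀ i, Continuous (G i)) (hG' : ∀ i, Antitone (G i)) {a : ℝ} (ha : ∑ i, G i a = 1)
    {t : ℝ} (ht : t ∈ Set.Icc 0 1) :
    ∃ l, ∑ i, ((1 - t) * G i l + t * Real.exp (-l)) = 1 ∧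
      ∀ i, (1 - t) * |G i l - G i a| ≤ t * |Fintype.card ι * Real.exp (-a) - 1| := by
  have : Nonempty ι := Finset.univ_nonempty_iff.1
    (Finset.nonempty_of_sum_ne_zero (ha ▸ one_ne_zero))
  have hcard : (0 : ℝ) < Fintype.card ι := by exact_mod_cast Fintype.card_pos
  have hH' : Antitone fun l => Fintype.card ι * Real.exp (-l) := fun s t hst => by
    dsimp only; gcongr
  have hb : Fintype.card ι * Real.exp (-Real.log (Fintype.card ι)) = 1 := by
    rw [Real.exp_neg, Real.exp_log hcard, mul_inv_cancel₀ hcard.ne']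
  obtain ⟨l, hl, hsum⟩ := exists_mem_uIcc_convexCombo_eq (D := fun l => ∑ i, G i l)
    (continuous_finsetSum _ fun i _ => hG i)
    (fun s t hst => Finset.sum_le_sum fun i _ => hG' i hst) (by fun_prop) hH' ha hb ht
  have hdev := fun i => abs_sub_le_abs_sum_sub_of_antitone hG' i l a
  have hdev_exp : |Fintype.card ι * Real.exp (-l) - 1| ≤ |Fintype.card ι * Real.exp (-a) - 1| := by
    have hmem := Set.abs_sub_right_of_mem_uIcc (hH'.mapsTo_uIcc hl)
    beta_reduce at hmem
    rwa [hb, abs_sub_comm, abs_sub_comm 1] at hmem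
  have hbalance : (1 - t) * (∑ j, G j l - 1) = -(t * (Fintype.card ι * Real.exp (-l) - 1)) := by
    linarith
  rw [ha] at hdev
  refine ⟨l, ?_, fun i => ?_⟩
  · rw [Finset.sum_add_distrib, ← Finset.mul_sum, Finset.sum_const, nsmul_eq_mul,
      Finset.card_univ, mul_left_comm, hsum]
  calc (1 - t) * |G i l - G i a| ≤ (1 - t) * |∑ j, G j l - 1| :=
        mul_le_mul_of_nonneg_left (hdev i) (sub_nonneg.2 ht.2)
    _ = t * |Fintype.card ι * Real.exp (-l) - 1| := by
        simpa only [abs_neg, abs_mul, abs_of_nonneg (sub_nonneg.2 ht.2), abs_of_nonneg ht.1]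
          using congrArg abs hbalance
    _ ≤ t * |Fintype.card ι * Real.exp (-a) - 1| := mul_le_mul_of_nonneg_left hdev_exp ht.1

variable {n : ℕ} {𝒮 : Finset (Finset (Fin n))} {x y : ChoiceVec 𝒮} {l : 𝒮 → ℝ}

lemma mem_representable_of_strictAntiIn (hx : ∀ S, x S ∈ stdSimplex ℝ S.1)
    (hpos : ∀ S i, 0 < x S i) (h : StrictAntiIn x l) : x ∈ representable 𝒮 := by
  have hmarg : ∀ i : Fin n, ∃ μ, IsMarginal μ ∧
      ∀ S : {S : 𝒮 // i ∈ S.1}, μ.real (Set.Ioi (l S)) = x S ⟨i, S.2⟩ := fun i =>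
    exists_isMarginal_real_Ioi_eq (fun S T => h S T i S.2 T.2) fun S =>
      ⟨hpos S _, (mem_Icc_of_mem_stdSimplex (hx S) _).2⟩
  choose F hF htail using hmarg
  have := fun i => (hF i).isProbabilityMeasure
  have := fun i => (hF i).nullSingletonClass
  have hprob : ∀ (S : 𝒮) (i : S.1),
      (F i).real (Set.Ioi (l S - (0 : Fin n → ℝ) i)) = x S i := fun S i => by
    rw [Pi.zero_apply, sub_zero, htail i ⟨S, i.2⟩]
  refine ⟨F, 0, hF, fun S => ?_⟩
  have hsum : ∑ i ∈ S.1, (F i).real (Set.Ioi (l S - (0 : Fin n → ℝ) i)) = 1 := by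
    rw [← Finset.sum_coe_sort S.1 fun i => (F i).real (Set.Ioi (l S - (0 : Fin n → ℝ) i)),
      ← (hx S).2]
    exact Finset.sum_congr rfl fun i _ => hprob S i
  obtain ⟨θ, hθ, hchoice⟩ := exists_isExtremal (fun i => (hF i).integrable) hsum
  exact ⟨θ, hθ, fun i => (hprob S i).symm.trans (hchoice i i.2).symm⟩

lemma exists_mem_Ioo_mul_lt {ι : Type*} [Finite ι] (c d : ι → ℝ) :
    ∃ t ∈ Set.Ioo (0 : ℝ) 1, ∀ i, 0 < d i → t * c i < (1 - t) * d i := by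
  have hsmall : ∀ᶠ t : ℝ in 𝓝[>] 0, ∀ i, 0 < d i → t * c i < (1 - t) * d i := by
    refine Filter.eventually_all.2 fun i => Filter.eventually_imp_distrib_left.2 fun hd => ?_
    refine nhdsWithin_le_nhds (ContinuousAt.eventually_lt (by fun_prop) (by fun_prop) ?_)
    simpa using hd
  obtain ⟨t, ht, ht'⟩ := (hsmall.and (Ioo_mem_nhdsGT one_pos)).exists
  exact ⟨t, ht', ht⟩

-- Interpolate `x` by antitone functions of the multiplier, mix in a little of `exp (-l)` to make
-- them strictly antitone, and move the multipliers so that the probabilities still add up to one: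
-- the move is too small to reverse a strict inequality between entries of `x`.
lemma AntitoneIn.exists_strictAntiIn (hx : ∀ S, x S ∈ stdSimplex ℝ S.1) {a : 𝒮 → ℝ}
    (h : AntitoneIn x a) :
    ∃ (y : ChoiceVec 𝒮) (l : 𝒮 → ℝ), (∀ S, y S ∈ stdSimplex ℝ S.1) ∧ (∀ S i, 0 < y S i) ∧
      StrictAntiIn y l ∧ AntitoneIn x l := by
  choose G hG hG' hG_nonneg hGx using fun i : Fin n =>
    exists_continuous_antitone_eq (ι := {S : 𝒮 // i ∈ S.1}) (a := fun S => a S)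
      (z := fun S => x S ⟨i, S.2⟩) (fun S T => h S T i S.2 T.2) fun S => (hx S).1 _
  let C : 𝒮 → ℝ := fun S => |Fintype.card S.1 * Real.exp (-a S) - 1|
  obtain ⟨t, ht, hgap⟩ := exists_mem_Ioo_mul_lt
    (ι := (i : Fin n) × {S : 𝒮 // i ∈ S.1} × {S : 𝒮 // i ∈ S.1})
    (fun p => C p.2.1 + C p.2.2) fun p => x p.2.2 ⟨p.1, p.2.2.2⟩ - x p.2.1 ⟨p.1, p.2.1.2⟩
  have ht' : 0 < 1 - t := sub_pos.2 ht.2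
  choose l hl hdev using fun S : 𝒮 => exists_sum_add_exp_eq_one (ι := S.1) (a := a S)
    (fun i => hG i) (fun i => hG' i)
    ((Finset.sum_congr rfl fun i _ => hGx i.1 ⟨S, i.2⟩).trans (hx S).2) (Set.Ioo_subset_Icc_self ht)
  have hpos : ∀ i s, 0 < (1 - t) * G i s + t * Real.exp (-s) := fun i s =>
    add_pos_of_nonneg_of_pos (mul_nonneg ht'.le (hG_nonneg i s)) (mul_pos ht.1 (Real.exp_pos _))
  have hanti : ∀ i, StrictAnti fun s => (1 - t) * G i s + t * Real.exp (-s) := fun i =>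
    ((hG' i).const_mul ht'.le).add_strictAnti fun s s' hs =>
      mul_lt_mul_of_pos_left (Real.exp_lt_exp.2 (neg_lt_neg hs)) ht.1
  refine ⟨fun S i => (1 - t) * G i (l S) + t * Real.exp (-l S), l,
    fun S => ⟨fun i => (hpos i _).le, hl S⟩, fun S i => hpos i _,
    fun S T i _ _ => (hanti i).le_iff_ge, fun S T i hS hT hST => ?_⟩
  by_contra! hlt
  have hx_lt := hgap ⟨i, ⟨S, hS⟩, ⟨T, hT⟩⟩ (sub_pos.2 hlt)
  have hdevS := hdev S ⟨i, hS⟩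
  have hdevT := hdev T ⟨i, hT⟩
  rw [hGx i ⟨S, hS⟩] at hdevS
  rw [hGx i ⟨T, hT⟩] at hdevT
  have hGS := mul_le_mul_of_nonneg_left (le_abs_self (G i (l S) - x S ⟨i, hS⟩)) ht'.le
  have hGT := mul_le_mul_of_nonneg_left (neg_le_abs (G i (l T) - x T ⟨i, hT⟩)) ht'.le
  have hG_le := mul_le_mul_of_nonneg_left (hG' i hST) ht'.le
  linarith

lemma AntitoneIn.lineMap_strictAntiIn (hx : AntitoneIn x l) (hy : StrictAntiIn y l) {t : ℝ}
    (ht : t ∈ Set.Ioc 0 1) : StrictAntiIn (AffineMap.lineMap x y t) l := by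
  intro S T i hS hT
  simp only [AffineMap.lineMap_apply_module, Pi.add_apply, Pi.smul_apply, smul_eq_mul]
  have ht' : 0 ≤ 1 - t := sub_nonneg.2 ht.2
  refine ⟨fun hle => ?_, fun hST => add_le_add (mul_le_mul_of_nonneg_left (hx S T i hS hT hST) ht')
    (mul_le_mul_of_nonneg_left ((hy S T i hS hT).2 hST) ht.1.le)⟩
  by_contra! hTS
  have hx_le := hx T S i hT hS hTS.le
  have hy_lt := lt_of_not_ge (mt (hy S T i hS hT).1 hTS.not_ge)
  exact hle.not_gt (add_lt_add_of_le_of_lt (mul_le_mul_of_nonneg_left hx_le ht')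
    (mul_lt_mul_of_pos_left hy_lt ht.1))

lemma exists_lineMap_mem_representable (hx : x ∈ rankable 𝒮) :
    ∃ y : ChoiceVec 𝒮, (∀ S, y S ∈ stdSimplex ℝ S.1) ∧
      ∀ t ∈ Set.Ioc (0 : ℝ) 1, AffineMap.lineMap x y t ∈ representable 𝒮 := by
  obtain ⟨hx, a, ha⟩ := hx
  obtain ⟨y, l, hy, hpos, hyl, hxl⟩ := ha.exists_strictAntiIn hx
  refine ⟨y, hy, fun t ht => mem_representable_of_strictAntiIn (fun S => ?_) (fun S i => ?_)
    (hxl.lineMap_strictAntiIn hyl ht)⟩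
  · rw [AffineMap.pi_lineMap_apply]
    exact (convex_stdSimplex ℝ S.1).lineMap_mem (hx S) (hy S) (Set.Ioc_subset_Icc_self ht)
  · simp only [AffineMap.lineMap_apply_module, Pi.add_apply, Pi.smul_apply, smul_eq_mul]
    exact add_pos_of_nonneg_of_pos (mul_nonneg (sub_nonneg.2 ht.2) ((hx S).1 i))
      (mul_pos ht.1 (hpos S i))

end Perturbation

section Limit

open Filter Topology

/-- Upper semicontinuity of `f` along segments of `s`, at an endpoint of the segment: the common
regularity of finite convex functions and of continuous functions. -/
def RadiallyUpperSemicontinuousOn {E : Type*} [AddCommGroup E] [Module ℝ E] (f : E → ℝ≥0∞)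
    (s : Set E) : Prop :=
  ∀ x ∈ s, ∀ y ∈ s,
    UpperSemicontinuousWithinAt (fun t : ℝ => f (AffineMap.lineMap x y t)) (Set.Ioi 0) 0

lemma radiallyUpperSemicontinuousOn_of_convexOn {E : Type*} [AddCommGroup E] [Module ℝ E]
    {f : E → ℝ≥0∞} {s : Set E} (hf : ConvexOn ℝ≥0 s f) (hfin : ∀ x ∈ s, f x ≠ ∞) :
    RadiallyUpperSemicontinuousOn f s := by
  intro x hx y hy b hb
  simp only [AffineMap.lineMap_apply_zero] at hb
  have hchord : Tendsto (fun t : ℝ => (1 - t).toNNReal • f x + t.toNNReal • f y) (𝓝[>] 0)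
      (𝓝 (f x)) := by
    have hcont : Continuous fun t : ℝ => (1 - t).toNNReal • f x + t.toNNReal • f y := by
      simp only [ENNReal.smul_def, smul_eq_mul]
      exact ((ENNReal.continuous_mul_const (hfin x hx)).comp (by fun_prop)).add
        ((ENNReal.continuous_mul_const (hfin y hy)).comp (by fun_prop))
    simpa using (hcont.tendsto 0).mono_left nhdsWithin_le_nhds
  filter_upwards [hchord.eventually_lt_const hb, Ioo_mem_nhdsGT one_pos] with t ht ht'
  refine lt_of_le_of_lt ?_ ht
  have hsum : (1 - t).toNNReal + t.toNNReal = 1 := by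
    rw [← Real.toNNReal_add (sub_nonneg.2 ht'.2.le) ht'.1.le, sub_add_cancel, Real.toNNReal_one]
  have hle := hf.2 hx hy zero_le zero_le hsum
  rwa [NNReal.smul_def, NNReal.smul_def, Real.coe_toNNReal _ (sub_nonneg.2 ht'.2.le),
    Real.coe_toNNReal _ ht'.1.le, ← AffineMap.lineMap_apply_module] at hle

lemma radiallyUpperSemicontinuousOn_of_continuousOn {E : Type*} [AddCommGroup E] [Module ℝ E]
    [TopologicalSpace E] [ContinuousAdd E] [ContinuousSMul ℝ E]
    {f : E → ℝ≥0∞} {s : Set E} (hs : Convex ℝ s) (hf : ContinuousOn f s) :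
    RadiallyUpperSemicontinuousOn f s := by
  intro x hx y hy
  have hline : ContinuousWithinAt (fun t : ℝ => AffineMap.lineMap x y t) (Set.Icc (0 : ℝ) 1) 0 := by
    simp only [AffineMap.lineMap_apply_module]
    exact Continuous.continuousWithinAt (by fun_prop)
  have hcomp : ContinuousWithinAt (fun t : ℝ => f (AffineMap.lineMap x y t))
      (Set.Icc (0 : ℝ) 1) 0 :=
    ContinuousWithinAt.comp (by simpa using hf x hx) hline fun t ht => hs.lineMap_mem hx hy ht
  exact (hcomp.mono_of_mem_nhdsWithin (Icc_mem_nhdsGT one_pos)).upperSemicontinuousWithinAt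

variable {n : ℕ} {𝒮 : Finset (Finset (Fin n))}
  {loss : (S : 𝒮) → (S.1 → ℝ) → (S.1 → ℝ) → ℝ≥0∞} {p x : ChoiceVec 𝒮}

lemma limit_le_totalLoss
    (husc : ∀ S : 𝒮, RadiallyUpperSemicontinuousOn (loss S (p S)) (stdSimplex ℝ S.1))
    (hx : x ∈ rankable 𝒮) : limit loss p ≤ totalLoss loss p x := by
  obtain ⟨y, hy, hrep⟩ := exists_lineMap_mem_representable hx
  have husc_total : UpperSemicontinuousWithinAt
      (fun t : ℝ => totalLoss loss p (AffineMap.lineMap x y t)) (Set.Ioi 0) 0 := by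
    simp only [totalLoss, AffineMap.pi_lineMap_apply]
    exact upperSemicontinuousWithinAt_sum fun S _ => husc S _ (hx.1 S) _ (hy S)
  refine le_of_forall_gt fun b hb => ?_
  obtain ⟨t, htb, ht⟩ := ((husc_total b (by simpa using hb)).and (Ioc_mem_nhdsGT one_pos)).exists
  exact (sInf_le (Set.mem_image_of_mem _ (hrep t ht))).trans_lt htb

lemma limit_eq_sInf_image_rankable (hne : ∀ S : 𝒮, S.1.Nonempty)
    (husc : ∀ S : 𝒮, RadiallyUpperSemicontinuousOn (loss S (p S)) (stdSimplex ℝ S.1)) :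
    limit loss p = sInf (totalLoss loss p '' rankable 𝒮) :=
  le_antisymm (le_sInf (Set.forall_mem_image.2 fun _ => limit_le_totalLoss husc))
    (sInf_le_sInf (Set.image_mono (representable_subset_rankable hne)))

lemma exists_isLeast_image_rankable (hne : ∀ S : 𝒮, S.1.Nonempty)
    (hlsc : ∀ S : 𝒮, LowerSemicontinuousOn (loss S (p S)) (stdSimplex ℝ S.1)) :
    ∃ v, IsLeast (totalLoss loss p '' rankable 𝒮) v := by
  have hlsc_total : LowerSemicontinuousOn (totalLoss loss p) (rankable 𝒮) :=
    lowerSemicontinuousOn_sum fun S _ =>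
      (hlsc S).comp (continuous_apply S).continuousOn fun x hx => hx.1 S
  obtain ⟨x, hx, hmin⟩ := hlsc_total.exists_isMinOn (rankable_nonempty hne) isCompact_rankable
  exact ⟨_, Set.mem_image_of_mem _ hx, Set.forall_mem_image.2 hmin⟩

end Limit

end MDM

open MDM in
theorem proposition5_general {n : ℕ} {𝒮 : Finset (Finset (Fin n))}
    (hne : ∀ S : 𝒮, S.1.Nonempty)
    {loss : (S : 𝒮) → (S.1 → ℝ) → (S.1 → ℝ) → ℝ≥0∞} {p : ChoiceVec 𝒮}
    (husc : ∀ S : 𝒮, RadiallyUpperSemicontinuousOn (loss S (p S)) (stdSimplex ℝ S.1))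
    {ε : ℝ} (hε : 0 < ε) (hε' : ε * (𝒮.card - 1) ≤ 1) :
    limit loss p = sInf (feasibleValues loss p ε) ∧
      ((∀ S : 𝒮, LowerSemicontinuousOn (loss S (p S)) (stdSimplex ℝ S.1)) →
        IsLeast (feasibleValues loss p ε) (limit loss p)) := by
  rw [feasibleValues_eq_image loss p hε hε', limit_eq_sInf_image_rankable hne husc]
  refine ⟨rfl, fun hlsc => ?_⟩
  obtain ⟨v, hv⟩ := exists_isLeast_image_rankable hne hlsc
  rwa [hv.isGLB.sInf_eq]

theorem proposition5 {n : ℕ} (𝒮 : Finset (Finset (Fin n)))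
    (p : MDM.ChoiceVec 𝒮) (hp : ∀ S : 𝒮, p S ∈ stdSimplex ℝ S.1)
    (loss : (S : 𝒮) → (S.1 → ℝ) → (S.1 → ℝ) → ℝ≥0∞)
    (hconv : ∀ S : 𝒮, ConvexOn ℝ≥0 (stdSimplex ℝ S.1) (loss S (p S)))
    (hreg : ∀ S : 𝒮, (∀ y ∈ stdSimplex ℝ S.1, loss S (p S) y ≠ ∞) ∨
      ContinuousOn (loss S (p S)) (stdSimplex ℝ S.1))
    (ε : ℝ) (hε : 0 < ε) (hε' : ε < 1 / (2 * (𝒮.card : ℝ))) :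
    MDM.limit loss p = sInf (MDM.feasibleValues loss p ε) ∧
      ((∀ S : 𝒮, ContinuousOn (loss S (p S)) (stdSimplex ℝ S.1)) →
        IsLeast (MDM.feasibleValues loss p ε) (MDM.limit loss p)) := by
  have hne : ∀ S : 𝒮, S.1.Nonempty := fun S => by
    by_contra hS
    have : IsEmpty S.1 := Finset.isEmpty_coe_sort.2 (Finset.not_nonempty_iff_eq_empty.1 hS)
    simpa [stdSimplex_of_isEmpty_index] using hp S
  have husc : ∀ S : 𝒮, MDM.RadiallyUpperSemicontinuousOn (loss S (p S)) (stdSimplex ℝ S.1) :=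
    fun S => (hreg S).elim (MDM.radiallyUpperSemicontinuousOn_of_convexOn (hconv S))
      (MDM.radiallyUpperSemicontinuousOn_of_continuousOn (convex_stdSimplex ℝ S.1))
  have hcard : (0 : ℝ) < 2 * 𝒮.card := one_div_pos.1 (hε.trans hε')
  have hmul : ε * (2 * 𝒮.card) < 1 := (lt_div_iff₀ hcard).1 hε'
  have hgap : ε * (𝒮.card - 1) ≤ 1 := by linarith [mul_pos hε hcard]
  obtain ⟨hlimit, hleast⟩ := proposition5_general hne husc hε hgap
  exact ⟨hlimit, fun hcont => hleast fun S => (hcont S).lowerSemicontinuousOn⟩
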